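/- Let $k\ge 1$ be an integer. A (finite) $k$-uniform hypergraph $H$ consists of a finite vertex set $V(H)$ and a set $E(H)$ of $k$-element subsets of $V(H)$; write $v(H)=|V(H)|$ and $e(H)=|E(H)|$. A homomorphism from $G$ to $F$ is a map $V(G)\to V(F)$ sending every edge of $G$ onto an edge of $F$. For $k$-uniform hypergraphs $F$ and $G$, let $\mathrm{ex}_k(n,G)$ be the maximum number of edges of a $k$-uniform hypergraph on $n$ vertices containing no copy of $G$ as a (not necessarily induced) sub-hypergraph, and let $\mathrm{ex}_F(n,G)$ be the maximum number of pairwise edge-disjoint copies of $F$ on a set of $n$ vertices such that there is no copy of $G$ whose edges come from pairwise distinct copies of $F$ in the family. Let $\chi(F)$ be the least number of colours in a vertex colouring of $F$ in which the vertices of each edge receive pairwise distinct colours. Let $F$ and $G$ be $k$-uniform hypergraphs such that $F$ has at least one edge and there is no homomorphism from $G$ to $F$. Then, as $n\to\infty$, $$\frac{n^k}{v(F)^k}+o(n^k)\ \le\ \mathrm{ex}_F(n,G)\ \le\ \frac{\mathrm{ex}_k(n,G)}{e(F)}+o(n^k).$$ If moreover $\chi(F)=k$ (that is, $F$ is $k$-partite),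 then $$\mathrm{ex}_F(n,G)=\frac{\mathrm{ex}_k(n,G)}{e(F)}+o(n^k).$$ -/

import Mathlib

open Asymptotics Filter

namespace Hypergraph

/-- `H` is `k`-uniform: every edge consists of exactly `k` vertices. -/
def IsUniform {α : Type*} (H : Hypergraph α) (k : ℕ) : Prop :=
  ∀ e ∈ H.edgeSet, e.encard = k

/-- There is a homomorphism from `G` to `F`: a map of vertices to vertices under which the image of
every edge of `G` is an edge of `F`. -/
def HasHom {α β : Type*} (G : Hypergraph α) (F : Hypergraph β) : Prop :=
  ∃ f : α → β, Set.MapsTo f G.vertexSet F.vertexSet ∧ ∀ e ∈ G.edgeSet, f '' e ∈ F.edgeSet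

/-- `C` is a copy of `F`, that is, the image of `F` under a relabelling that is injective on the
vertices of `F`. -/
def IsCopy {α β : Type*} (F : Hypergraph α) (C : Hypergraph β) : Prop :=
  ∃ f : α → β, Set.InjOn f F.vertexSet ∧ C = F.image f

/-- `H` contains a copy of `G` as a (not necessarily induced) sub-hypergraph. -/
def ContainsCopy {α β : Type*} (H : Hypergraph β) (G : Hypergraph α) : Prop :=
  ∃ D : Hypergraph β, G.IsCopy D ∧ D.vertexSet ⊆ H.vertexSet ∧ D.edgeSet ⊆ H.edgeSet

/-- The family `C` (the member `C i` is given the colour `i`) contains a rainbow copy of `G`: a copy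
of `G` whose edges come from pairwise distinct members of the family. -/
def HasRainbowCopy {α β ι : Type*} (C : ι → Hypergraph β) (G : Hypergraph α) : Prop :=
  ∃ D : Hypergraph β, G.IsCopy D ∧
    ∃ c : D.edgeSet → ι, Function.Injective c ∧ ∀ e : D.edgeSet, (e : Set β) ∈ (C (c e)).edgeSet

/-- The `F`-multicolor Turán number `ex_F(n, G)`: the maximum number of pairwise edge-disjoint
copies of `F` on `n` vertices without a rainbow copy of `G`. The maximum exists when both
hypergraphs have an edge. -/
noncomputable def multicolorTuranNumber {α β : Type*} (F : Hypergraph α) (G : Hypergraph β)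
    (n : ℕ) : ℕ :=
  sSup {m : ℕ | ∃ C : Fin m → Hypergraph (Fin n),
    (∀ i, F.IsCopy (C i)) ∧
    (∀ i j, i ≠ j → Disjoint (C i).edgeSet (C j).edgeSet) ∧
    ¬ HasRainbowCopy C G}

/-- The Turán number `ex_k(n, G)`: the maximum number of edges of a `k`-uniform hypergraph on `n`
vertices that contains no copy of `G`. -/
noncomputable def turanNumber {β : Type*} (k : ℕ) (G : Hypergraph β) (n : ℕ) : ℕ :=
  sSup {m : ℕ | ∃ H : Hypergraph (Fin n), H.vertexSet = Set.univ ∧ H.IsUniform k ∧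
    ¬ H.ContainsCopy G ∧ H.edgeSet.ncard = m}

/-- The (strong) chromatic number of a finite hypergraph: the least number of colours in a colouring
of the vertices that gives distinct colours to the vertices of each edge. For a `k`-uniform
hypergraph with at least one edge it is at least `k`, with equality exactly for `k`-partite ones. -/
noncomputable def chromaticNumber {α : Type*} (H : Hypergraph α) : ℕ :=
  sInf {m : ℕ | ∃ c : α → ℕ, (∀ x ∈ H.vertexSet, c x < m) ∧ ∀ e ∈ H.edgeSet, Set.InjOn c e}

end Hypergraph

/-! Upper bound: colour each edge of an extremal family by its copy of `F`. In a random `N`-set of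
vertices a given edge survives with probability about `(N/n)^k`, but two edges of one colour span at
least `k + 1` vertices, so equally coloured pairs are rarer by a factor `O(1/n)`. Deleting an edge
from each such pair leaves a rainbow, hence `G`-free, family of at most `ex_k(N, G)` edges
(`card_le_of_no_rainbow`). With one edge per colour the same count shows that Turán densities
decrease, so a fixed `N` of nearly limiting density suffices.

Lower bound: blow up `F` with parts of size `M`, about `n / v(F)`. Each polynomial of degree less
than `k` over `ZMod M` gives a copy of `F`, its value at `u` selecting a vertex in part `u`. Copies
sharing an edge agree at `k` points and coincide. Projecting the blow-up to `F` would turn a copy of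
`G` into a homomorphism.

For `k`-partite `F`, Erdős' theorem (`eventually_exists_blowup`) lets copies of `F` be removed
greedily from an extremal `G`-free hypergraph until only `o(n^k)` edges remain. -/

namespace Hypergraph

open scoped Finset BigOperators

/-! ### Upper bound by averaging over vertex subsets -/

section Turan

variable {α β : Type*}

lemma IsCopy.image_of_injective {γ : Type*} {G : Hypergraph α} {D : Hypergraph β}
    (h : G.IsCopy D) {f : β → γ} (hf : f.Injective) : G.IsCopy (D.image f) := by
  obtain ⟨g, hg, rfl⟩ := h
  exact ⟨f ∘ g, fun x hx y hy hxy => hg hx hy (hf hxy), image_image G⟩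

lemma IsCopy.isUniform {G : Hypergraph α} {D : Hypergraph β} {k : ℕ} (h : G.IsCopy D)
    (hG : G.IsUniform k) : D.IsUniform k := by
  obtain ⟨g, hg, rfl⟩ := h
  rintro _ ⟨e, he, rfl⟩
  rw [(hg.mono he.subset_vertexSet).encard_image, hG e he]

lemma IsCopy.ncard_edgeSet {G : Hypergraph α} {D : Hypergraph β} (h : G.IsCopy D) :
    D.edgeSet.ncard = G.edgeSet.ncard := by
  obtain ⟨g, hg, rfl⟩ := h
  refine Set.InjOn.ncard_image ?_
  intro e he e' he' hee
  exact (hg.image_eq_image_iff he.subset_vertexSet he'.subset_vertexSet).1 hee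

lemma IsCopy.edgeSet_nonempty {G : Hypergraph α} {D : Hypergraph β} (h : G.IsCopy D)
    (hG : G.edgeSet.Nonempty) : D.edgeSet.Nonempty := by
  obtain ⟨g, hg, rfl⟩ := h
  exact hG.image _

lemma IsUniform.ncard_eq {H : Hypergraph α} {k : ℕ} (h : H.IsUniform k) {e : Set α}
    (he : e ∈ H.edgeSet) : e.ncard = k := by
  simp [Set.ncard, h e he]

/-- The hypergraph on the vertex set `Set.univ` with prescribed edges. -/
@[simps]
def ofEdges (E : Set (Set α)) : Hypergraph α where
  vertexSet := Set.univ
  edgeSet := E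
  subset_vertexSet_of_mem_edgeSet' := fun _ _ => Set.subset_univ _

lemma bddAbove_turanNumber (k : ℕ) (G : Hypergraph β) (n : ℕ) :
    BddAbove {m : ℕ | ∃ H : Hypergraph (Fin n), H.vertexSet = Set.univ ∧ H.IsUniform k ∧
      ¬ H.ContainsCopy G ∧ H.edgeSet.ncard = m} := by
  refine ⟨Nat.card (Set (Fin n)), ?_⟩
  rintro m ⟨H, -, -, -, rfl⟩
  exact Set.ncard_le_card _

/-- A uniform family of edges inside an `N`-element set of vertices that contains no copy of `G`
has at most `ex_k(N, G)` members. -/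
lemma ncard_le_turanNumber {k n N : ℕ} {G : Hypergraph β} {A : Finset (Fin n)} (hA : #A = N)
    {E : Set (Set (Fin n))} (hEA : ∀ e ∈ E, e ⊆ A) (hEk : ∀ e ∈ E, e.ncard = k)
    (hG : ∀ D, G.IsCopy D → ¬ D.edgeSet ⊆ E) : E.ncard ≤ turanNumber k G N := by
  let φ := A.orderEmbOfFin hA
  have hφ : Function.Injective φ := φ.injective
  have hr : Set.range φ = A := A.range_orderEmbOfFin hA
  let E' : Set (Set (Fin N)) := {s | φ '' s ∈ E}
  have hE' : E = (φ '' ·) '' E' := by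
    ext e
    constructor
    · intro he
      obtain ⟨s, rfl⟩ := Set.subset_range_iff_exists_image_eq.1 (hr ▸ hEA e he)
      exact ⟨s, he, rfl⟩
    · rintro ⟨s, hs, rfl⟩
      exact hs
  rw [hE', Set.ncard_image_of_injective _ hφ.image_injective]
  refine le_csSup (bddAbove_turanNumber k G N) ⟨ofEdges E', rfl, ?_, ?_, rfl⟩
  · intro s hs
    rw [← (hφ.encard_image s), ← hEk _ hs, Set.Finite.cast_ncard_eq (Set.toFinite _)]
  · rintro ⟨D, hD, -, hDE⟩
    refine hG _ (hD.image_of_injective hφ) ?_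
    rintro _ ⟨s, hs, rfl⟩
    exact hDE hs

/-- The empty hypergraph competes because `G` has an edge, so the supremum is attained. -/
lemma exists_turanNumber {G : Hypergraph β} (hG : G.edgeSet.Nonempty) (k n : ℕ) :
    ∃ H : Hypergraph (Fin n), H.vertexSet = Set.univ ∧ H.IsUniform k ∧
      ¬ H.ContainsCopy G ∧ H.edgeSet.ncard = turanNumber k G n := by
  refine Nat.sSup_mem ?_ (bddAbove_turanNumber k G n)
  refine ⟨0, ofEdges ∅, rfl, ?_, ?_, ?_⟩
  · intro e he
    exact he.elim
  · rintro ⟨D, hD, -, hDE⟩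
    obtain ⟨e, he⟩ := hD.edgeSet_nonempty hG
    exact hDE he
  · simp

/-- Averaging over the `N`-subsets `A` of the vertices: in each of them, deleting one edge from every
pair of equally coloured edges leaves a rainbow family. -/
lemma card_mul_choose_le_of_no_rainbow {ι : Type*} [DecidableEq ι] {k n N q : ℕ} {G : Hypergraph β}
    (hkN : k + 1 ≤ N) (E : Finset (Set (Fin n))) (hEk : ∀ e ∈ E, e.ncard = k)
    (col : Set (Fin n) → ι) (hq : ∀ i, #{e ∈ E | col e = i} ≤ q + 1)
    (hG : ∀ D, G.IsCopy D → D.edgeSet ⊆ E → ¬ Set.InjOn col D.edgeSet) :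
    #E * (n - k).choose (N - k) ≤
      n.choose N * turanNumber k G N + #E * q * (n - (k + 1)).choose (N - (k + 1)) := by
  classical
  have hcount (e : Set (Fin n)) (he : e.ncard ≤ N) :
      #((Finset.powersetCard N Finset.univ).filter
        fun A : Finset (Fin n) => e ⊆ (A : Set (Fin n))) =
        (n - e.ncard).choose (N - e.ncard) := by
    rw [Set.ncard_eq_toFinset_card'] at he ⊢
    have := Finset.card_filter_powersetCard_subset e.toFinset Finset.univ N
      (Finset.subset_univ _) he
    rw [Finset.card_univ, Fintype.card_fin] at this
    rw [← this]
    congr 1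
    ext A
    simp [← Finset.coe_subset]
  let B : Finset (Set (Fin n) × Set (Fin n)) := {p ∈ E ×ˢ E | p.1 ≠ p.2 ∧ col p.1 = col p.2}
  have hB : #B ≤ #E * q := by
    rw [Finset.card_eq_sum_card_fiberwise (f := Prod.fst) (t := E)
      (fun p hp => (Finset.mem_product.1 (Finset.mem_filter.1 hp).1).1)]
    refine Finset.sum_le_card_nsmul _ _ _ fun e he => ?_
    have hinj : #{p ∈ B | p.1 = e} ≤ #({e' ∈ E | col e' = col e}.erase e) := by
      refine Finset.card_le_card_of_injOn Prod.snd ?_ ?_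
      · intro p hp
        simp only [B, Finset.coe_filter, Finset.mem_filter, Finset.mem_product,
          Set.mem_ofPred_eq] at hp
        obtain ⟨⟨⟨h1, h2⟩, h3, h4⟩, rfl⟩ := hp
        simp [h2, h3.symm, h4.symm]
      · intro p hp p' hp' h
        exact Prod.ext ((Finset.mem_filter.1 hp).2.trans (Finset.mem_filter.1 hp').2.symm) h
    rw [Finset.card_erase_of_mem (by simp [he])] at hinj
    exact hinj.trans (by have := hq (col e); omega)
  have hA (A : Finset (Fin n)) (hA : A ∈ Finset.powersetCard N Finset.univ) :
      #{e ∈ E | e ⊆ (A : Set (Fin n))} ≤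
        turanNumber k G N + #{p ∈ B | p.1 ∪ p.2 ⊆ (A : Set (Fin n))} := by
    set EA : Finset (Set (Fin n)) := {e ∈ E | e ⊆ (A : Set (Fin n))} with hEA
    set BA : Finset (Set (Fin n) × Set (Fin n)) := {p ∈ B | p.1 ∪ p.2 ⊆ (A : Set (Fin n))} with hBA
    have hsub (e) (he : e ∈ EA \ BA.image Prod.fst) : e ∈ E ∧ e ⊆ A := by
      simpa [hEA] using (Finset.mem_sdiff.1 he).1
    -- After deletion of the first edge of every bad pair inside `A`, the colouring is injective, so
    -- no copy of `G` survives.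
    have hle : #(EA \ BA.image Prod.fst) ≤ turanNumber k G N := by
      rw [← Set.ncard_coe_finset]
      refine ncard_le_turanNumber (Finset.mem_powersetCard.1 hA).2
        (fun e he => (hsub e he).2) (fun e he => hEk e (hsub e he).1) fun D hD hDE => ?_
      refine hG D hD (fun e he => (hsub e (hDE he)).1) fun e he e' he' hee => ?_
      by_contra hne
      refine (Finset.mem_sdiff.1 (hDE he)).2 (Finset.mem_image.2 ⟨(e, e'), ?_, rfl⟩)
      have h1 := hsub e (hDE he)
      have h2 := hsub e' (hDE he')
      simp [hBA, B, h1, h2, hne, hee]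
    have h1 := Finset.le_card_sdiff (BA.image Prod.fst) EA
    have h2 := Finset.card_image_le (s := BA) (f := Prod.fst)
    omega
  have hsum : ∑ A ∈ Finset.powersetCard N (Finset.univ : Finset (Fin n)),
      #{e ∈ E | e ⊆ (A : Set (Fin n))} = #E * (n - k).choose (N - k) := by
    refine (Finset.sum_card_bipartiteAbove_eq_sum_card_bipartiteBelow
      (fun (A : Finset (Fin n)) (e : Set (Fin n)) => e ⊆ (A : Set (Fin n)))).trans ?_
    refine Finset.sum_const_nat fun e he => ?_
    have := hcount e (by rw [hEk e he]; omega)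
    rwa [hEk e he] at this
  have hsumB : ∑ A ∈ Finset.powersetCard N (Finset.univ : Finset (Fin n)),
      #{p ∈ B | p.1 ∪ p.2 ⊆ (A : Set (Fin n))} ≤
        #B * (n - (k + 1)).choose (N - (k + 1)) := by
    refine (Finset.sum_card_bipartiteAbove_eq_sum_card_bipartiteBelow
      (fun (A : Finset (Fin n)) (p : Set (Fin n) × Set (Fin n)) =>
        p.1 ∪ p.2 ⊆ (A : Set (Fin n)))).trans_le ?_
    refine Finset.sum_le_card_nsmul _ _ _ fun p hp => ?_
    simp only [B, Finset.mem_filter, Finset.mem_product] at hp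
    obtain ⟨⟨h1, h2⟩, h3, -⟩ := hp
    -- Distinct `k`-sets span at least `k + 1` vertices; this gains the factor `(N - k) / (n - k)`.
    obtain ⟨x, hx2, hx1⟩ : ∃ x ∈ p.2, x ∉ p.1 := by
      by_contra! hcon
      exact h3 (Set.eq_of_subset_of_ncard_le hcon (by rw [hEk _ h1, hEk _ h2])).symm
    have hcard : (insert x p.1).ncard = k + 1 := by
      rw [Set.ncard_insert_of_notMem hx1, hEk _ h1]
    rw [← hcard, ← hcount _ (by omega)]
    refine Finset.card_le_card fun A hA => ?_
    rw [Finset.bipartiteBelow, Finset.mem_filter] at hA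
    refine Finset.mem_filter.2 ⟨hA.1, Set.insert_subset (hA.2 (Or.inr hx2)) ?_⟩
    exact Set.subset_union_left.trans hA.2
  calc #E * (n - k).choose (N - k)
      = ∑ A ∈ Finset.powersetCard N (Finset.univ : Finset (Fin n)),
          #{e ∈ E | e ⊆ (A : Set (Fin n))} := hsum.symm
    _ ≤ ∑ A ∈ Finset.powersetCard N (Finset.univ : Finset (Fin n)),
          (turanNumber k G N + #{p ∈ B | p.1 ∪ p.2 ⊆ (A : Set (Fin n))}) :=
        Finset.sum_le_sum hA
    _ ≤ _ := by
        rw [Finset.sum_add_distrib, Finset.sum_const, smul_eq_mul, Finset.card_powersetCard,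
          Finset.card_univ, Fintype.card_fin]
        gcongr
        exact hsumB.trans (Nat.mul_le_mul_right _ hB)

/-- The averaging bound in normalised form. -/
lemma card_le_of_no_rainbow {ι : Type*} [DecidableEq ι] {k n N q : ℕ} {G : Hypergraph β}
    (hkN : k + 1 ≤ N) (hNn : N ≤ n) (E : Finset (Set (Fin n))) (hEk : ∀ e ∈ E, e.ncard = k)
    (col : Set (Fin n) → ι) (hq : ∀ i, #{e ∈ E | col e = i} ≤ q + 1)
    (hG : ∀ D, G.IsCopy D → D.edgeSet ⊆ E → ¬ Set.InjOn col D.edgeSet) :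
    (#E : ℝ) ≤ n.choose k * (turanNumber k G N / N.choose k : ℝ)
      + #E * q * ((N - k) / (n - k) : ℝ) := by
  have h := card_mul_choose_le_of_no_rainbow hkN E hEk col hq hG
  have h1 : n.choose N * N.choose k = n.choose k * (n - k).choose (N - k) :=
    Nat.choose_mul (by omega)
  have h2 : (n - k) * (n - (k + 1)).choose (N - (k + 1)) = (n - k).choose (N - k) * (N - k) := by
    have := Nat.add_one_mul_choose_eq (n - (k + 1)) (N - (k + 1))
    rwa [show n - (k + 1) + 1 = n - k by omega, show N - (k + 1) + 1 = N - k by omega] at this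
  have hc1 : (0 : ℝ) < N.choose k := by exact_mod_cast Nat.choose_pos (by omega)
  have hc2 : (0 : ℝ) < (n - k).choose (N - k) := by exact_mod_cast Nat.choose_pos (by omega)
  have hnk : (0 : ℝ) < n - k := by
    rw [sub_pos]; exact_mod_cast (by omega : k < n)
  have h' : (#E * (n - k).choose (N - k) : ℝ) ≤ n.choose N * turanNumber k G N +
      #E * q * (n - (k + 1)).choose (N - (k + 1)) := by exact_mod_cast h
  have h1' : (n.choose N * N.choose k : ℝ) = n.choose k * (n - k).choose (N - k) := by
    exact_mod_cast h1
  have h2' : ((n - k) * (n - (k + 1)).choose (N - (k + 1)) : ℝ) =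
      (n - k).choose (N - k) * (N - k) := by
    have : (((n - k : ℕ) : ℝ) * (n - (k + 1)).choose (N - (k + 1)) : ℝ) =
      (n - k).choose (N - k) * ((N - k : ℕ) : ℝ) := by exact_mod_cast h2
    rwa [Nat.cast_sub (by omega), Nat.cast_sub (by omega)] at this
  have e1 : (n.choose N : ℝ) = n.choose k * (n - k).choose (N - k) / N.choose k := by
    rw [eq_div_iff hc1.ne', h1']
  have e2 : ((n - (k + 1)).choose (N - (k + 1)) : ℝ) =
      (n - k).choose (N - k) * (N - k) / (n - k) := by
    rw [eq_div_iff hnk.ne', ← h2', mul_comm]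
  rw [e1, e2] at h'
  refine le_of_mul_le_mul_right (h'.trans_eq ?_) hc2
  ring

/-- The Turán density `ex_k(n, G) / C(n, k)` does not increase with `n`. -/
lemma turanNumber_div_choose_le {k n N : ℕ} {G : Hypergraph β} (hG : G.edgeSet.Nonempty)
    (hkN : k + 1 ≤ N) (hNn : N ≤ n) :
    (turanNumber k G n / n.choose k : ℝ) ≤ turanNumber k G N / N.choose k := by
  classical
  obtain ⟨H, hH, hHk, hHG, hcard⟩ := exists_turanNumber hG k n
  -- Every edge is its own colour, so `q = 0` and the error term vanishes.
  have h := card_le_of_no_rainbow (G := G) (q := 0) hkN hNn H.edgeSet.toFinset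
    (fun e he => hHk.ncard_eq (by simpa using he)) id
    (fun e => Finset.card_le_one.2 fun a ha b hb => by
      rw [Finset.mem_filter] at ha hb
      exact ha.2.trans hb.2.symm)
    (fun D hD hDE => (hHG ⟨D, hD, by simp [hH], by simpa using hDE⟩).elim)
  rw [← Set.ncard_eq_toFinset_card', hcard] at h
  have hc : (0 : ℝ) < n.choose k := by exact_mod_cast Nat.choose_pos (by omega)
  rw [div_le_iff₀ hc]
  linarith

/-- Choosing one edge from each copy injects the family into the finite set of all possible edges.
-/
lemma bddAbove_multicolorTuranNumber {F : Hypergraph α} (hF : F.edgeSet.Nonempty)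
    (G : Hypergraph β) (n : ℕ) :
    BddAbove {m : ℕ | ∃ C : Fin m → Hypergraph (Fin n),
      (∀ i, F.IsCopy (C i)) ∧
      (∀ i j, i ≠ j → Disjoint (C i).edgeSet (C j).edgeSet) ∧
      ¬ HasRainbowCopy C G} := by
  refine ⟨Fintype.card (Set (Fin n)), ?_⟩
  rintro m ⟨C, hC, hdisj, -⟩
  choose e he using fun i => (hC i).edgeSet_nonempty hF
  rw [← Fintype.card_fin m]
  refine Fintype.card_le_of_injective e fun i j hij => ?_
  by_contra hne
  exact Set.disjoint_left.1 (hdisj i j hne) (he i) (hij ▸ he j)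

lemma card_le_multicolorTuranNumber {ι : Type*} [Fintype ι] {F : Hypergraph α}
    (hF : F.edgeSet.Nonempty) {G : Hypergraph β} {n : ℕ} (C : ι → Hypergraph (Fin n))
    (hC : ∀ i, F.IsCopy (C i)) (hdisj : ∀ i j, i ≠ j → Disjoint (C i).edgeSet (C j).edgeSet)
    (hG : ¬ HasRainbowCopy C G) : Fintype.card ι ≤ multicolorTuranNumber F G n := by
  let φ := (Fintype.equivFin ι).symm
  refine le_csSup (bddAbove_multicolorTuranNumber hF G n)
    ⟨C ∘ φ, fun i => hC _, fun i j hij => hdisj _ _ (φ.injective.ne hij), ?_⟩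
  rintro ⟨D, hD, c, hc, hcD⟩
  exact hG ⟨D, hD, φ ∘ c, φ.injective.comp hc, hcD⟩

lemma exists_multicolorTuranNumber {F : Hypergraph α} (hF : F.edgeSet.Nonempty)
    {G : Hypergraph β} (hG : G.edgeSet.Nonempty) (n : ℕ) :
    ∃ C : Fin (multicolorTuranNumber F G n) → Hypergraph (Fin n),
      (∀ i, F.IsCopy (C i)) ∧
      (∀ i j, i ≠ j → Disjoint (C i).edgeSet (C j).edgeSet) ∧
      ¬ HasRainbowCopy C G := by
  refine Nat.sSup_mem ?_ (bddAbove_multicolorTuranNumber hF G n)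
  refine ⟨0, fun i => i.elim0, fun i => i.elim0, fun i => i.elim0, ?_⟩
  rintro ⟨D, hD, c, -⟩
  obtain ⟨e, he⟩ := hD.edgeSet_nonempty hG
  exact (c ⟨e, he⟩).elim0

/-- A multicolour Turán family consists of `ex_F(n, G) * e(F)` edges; the averaging bound applies to
them, coloured by the copy of `F` they belong to. -/
lemma multicolorTuranNumber_mul_le {k n N : ℕ} {F : Hypergraph α} {G : Hypergraph β}
    (hF : F.IsUniform k) (hFe : F.edgeSet.Nonempty) (hFfin : F.edgeSet.Finite)
    (hG : G.edgeSet.Nonempty) (hkN : k + 1 ≤ N) (hNn : N ≤ n) :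
    (multicolorTuranNumber F G n * F.edgeSet.ncard : ℝ) ≤
      n.choose k * (turanNumber k G N / N.choose k : ℝ)
        + n.choose k * F.edgeSet.ncard * ((N - k) / (n - k) : ℝ) := by
  classical
  obtain ⟨C, hC, hdisj, hCG⟩ := exists_multicolorTuranNumber hFe hG n
  let E : Finset (Set (Fin n)) := Finset.univ.biUnion fun i => (C i).edgeSet.toFinset
  have hcardC (i) : #(C i).edgeSet.toFinset = F.edgeSet.ncard := by
    rw [← Set.ncard_eq_toFinset_card', (hC i).ncard_edgeSet]
  have hEcard : #E = multicolorTuranNumber F G n * F.edgeSet.ncard := by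
    rw [Finset.card_biUnion fun i _ j _ hij => by simpa using hdisj i j hij]
    simp [hcardC]
  have hmem (e) : e ∈ E ↔ ∃ i, e ∈ (C i).edgeSet := by simp [E]
  have huniq {i j e} (hi : e ∈ (C i).edgeSet) (hj : e ∈ (C j).edgeSet) : i = j := by
    by_contra hne
    exact Set.disjoint_left.1 (hdisj i j hne) hi hj
  have hEk (e) (he : e ∈ E) : e.ncard = k := by
    obtain ⟨i, hi⟩ := (hmem e).1 he
    exact ((hC i).isUniform hF).ncard_eq hi
  -- On `E` this set of indices is a singleton; using sets avoids a default colour outside `E`.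
  let col : Set (Fin n) → Set (Fin (multicolorTuranNumber F G n)) :=
    fun e => {i | e ∈ (C i).edgeSet}
  have hpos : 0 < F.edgeSet.ncard := (Set.ncard_pos hFfin).2 hFe
  have h := card_le_of_no_rainbow (G := G) (q := F.edgeSet.ncard - 1) hkN hNn E hEk col ?_ ?_
  · rw [Nat.cast_sub hpos, Nat.cast_one] at h
    have hE : (#E : ℝ) ≤ n.choose k := by
      have : #E ≤ #((Finset.powersetCard k (Finset.univ : Finset (Fin n))).image
          (fun A : Finset (Fin n) => (A : Set (Fin n)))) := by
        refine Finset.card_le_card fun e he => Finset.mem_image.2 ⟨e.toFinset, ?_, by simp⟩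
        rw [Finset.mem_powersetCard, ← Set.ncard_eq_toFinset_card', hEk e he]
        simp
      have := this.trans Finset.card_image_le
      rw [Finset.card_powersetCard, Finset.card_univ, Fintype.card_fin] at this
      exact_mod_cast this
    have hEc : (#E : ℝ) = multicolorTuranNumber F G n * F.edgeSet.ncard := by
      exact_mod_cast hEcard
    rw [← hEc]
    refine h.trans ?_
    have hnk : (0 : ℝ) < n - k := by
      rw [sub_pos]; exact_mod_cast (by omega : k < n)
    have hNk : (0 : ℝ) < N - k := by
      rw [sub_pos]; exact_mod_cast (by omega : k < N)
    have h1 : (1 : ℝ) ≤ F.edgeSet.ncard := by exact_mod_cast hpos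
    gcongr
    linarith
  · intro i
    rw [Nat.sub_add_cancel hpos]
    obtain hempty | ⟨e, he⟩ := ({e ∈ E | col e = i} : Finset _).eq_empty_or_nonempty
    · simp [hempty]
    · rw [Finset.mem_filter, hmem] at he
      obtain ⟨⟨j, hj⟩, rfl⟩ := he
      rw [← hcardC j]
      refine Finset.card_le_card fun e' he' => ?_
      have : j ∈ col e' := by
        rw [(Finset.mem_filter.1 he').2]
        exact hj
      exact Set.mem_toFinset.2 this
  · intro D hD hDE hinj
    have hx (e : D.edgeSet) : ∃ i, (e : Set (Fin n)) ∈ (C i).edgeSet := (hmem _).1 (hDE e.2)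
    choose c hc using hx
    refine hCG ⟨D, hD, c, fun e e' hee => ?_, hc⟩
    refine Subtype.ext (hinj e.2 e'.2 ?_)
    ext i
    exact ⟨fun hi => by rw [huniq hi (hc e), hee]; exact hc e',
      fun hi => by rw [huniq hi (hc e'), ← hee]; exact hc e⟩

/-- `ex_F(n, G) e(F) ≤ ex_k(n, G) + o(n^k)`. -/
lemma eventually_multicolorTuranNumber_mul_le {k : ℕ} {F : Hypergraph α} {G : Hypergraph β}
    (hF : F.IsUniform k) (hFe : F.edgeSet.Nonempty) (hFfin : F.edgeSet.Finite)
    (hG : G.edgeSet.Nonempty) {ε : ℝ} (hε : 0 < ε) :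
    ∀ᶠ n : ℕ in atTop, (multicolorTuranNumber F G n * F.edgeSet.ncard : ℝ) ≤
      turanNumber k G n + ε * n ^ k := by
  -- The shift by `k + 1` makes the densities antitone from index 0.
  let a : ℕ → ℝ := fun i => turanNumber k G (i + (k + 1)) / (i + (k + 1)).choose k
  have ha : Antitone a := fun i j hij => turanNumber_div_choose_le hG (by omega) (by omega)
  have hbdd : BddBelow (Set.range a) := ⟨0, by rintro _ ⟨i, rfl⟩; positivity⟩
  obtain ⟨i, hi⟩ : ∃ i, a i < (⨅ i, a i) + ε / 2 := exists_lt_of_ciInf_lt (by linarith)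
  set N := i + (k + 1) with hN
  have hlim : Tendsto (fun n : ℕ => F.edgeSet.ncard * ((N - k) / (n - k) : ℝ)) atTop
      (nhds (F.edgeSet.ncard * 0)) := by
    refine Tendsto.const_mul _ (Tendsto.div_atTop tendsto_const_nhds ?_)
    exact tendsto_atTop_add_const_right _ (-(k : ℝ)) tendsto_natCast_atTop_atTop
  rw [mul_zero] at hlim
  filter_upwards [hlim.eventually (gt_mem_nhds (half_pos hε)), eventually_ge_atTop N]
    with n hn hNn
  have h := multicolorTuranNumber_mul_le (n := n) (N := N) hF hFe hFfin hG (by omega) hNn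
  have hc : (0 : ℝ) < n.choose k := by exact_mod_cast Nat.choose_pos (by omega)
  have hc' : (n.choose k : ℝ) ≤ n ^ k := by exact_mod_cast Nat.choose_le_pow n k
  have hinf : (⨅ i, a i) ≤ turanNumber k G n / n.choose k := by
    have := ciInf_le hbdd (n - (k + 1))
    simpa [a, Nat.sub_add_cancel (show k + 1 ≤ n by omega)] using this
  have h1 : (n.choose k : ℝ) * (turanNumber k G N / N.choose k) ≤
      turanNumber k G n + n.choose k * (ε / 2) := by
    calc (n.choose k : ℝ) * (turanNumber k G N / N.choose k)
        ≤ n.choose k * (turanNumber k G n / n.choose k + ε / 2) := by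
          gcongr
          exact hi.le.trans (by linarith)
      _ = _ := by field_simp
  have h2 : (n.choose k : ℝ) * F.edgeSet.ncard * ((N - k) / (n - k) : ℝ) ≤
      n.choose k * (ε / 2) := by
    rw [mul_assoc]
    gcongr
  nlinarith

end Turan

/-! ### Erdős' theorem and greedy packing for `k`-partite `F` -/

section Erdos

lemma expect_pow_le {ι : Type*} [Fintype ι] [Nonempty ι] {f : ι → ℝ} (hf : ∀ i, 0 ≤ f i) {p : ℕ}
    (hp : p ≠ 0) : (𝔼 i, f i) ^ p ≤ 𝔼 i, f i ^ p := by
  obtain ⟨q, rfl⟩ := Nat.exists_eq_succ_of_ne_zero hp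
  have h := pow_sum_div_card_le_sum_pow (s := Finset.univ) (fun i _ => hf i) q
  have hc : (0 : ℝ) < Fintype.card ι := by exact_mod_cast Fintype.card_pos
  rw [Finset.card_univ, div_le_iff₀ (by positivity)] at h
  simp_rw [Fintype.expect_eq_sum_div_card]
  rw [div_pow, div_le_div_iff₀ (by positivity) hc]
  calc _ ≤ (∑ i, f i ^ (q + 1)) * Fintype.card ι ^ q * Fintype.card ι := by gcongr
    _ = _ := by rw [Nat.succ_eq_add_one]; ring

lemma expect_fin_cons {X : Type*} [Fintype X] {k : ℕ} (f : (Fin (k + 1) → X) → ℝ) :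
    𝔼 x, f x = 𝔼 a, 𝔼 y, f (Fin.cons a y) := by
  rw [← Finset.expect_product' Finset.univ Finset.univ
    (fun (a : X) (y : Fin k → X) => f (Fin.cons a y)), Finset.univ_product_univ]
  exact (Fintype.expect_equiv (Fin.consEquiv fun _ => X) _ _ fun _ => rfl).symm

/-- The density of complete `k`-partite blow-ups is at least the corresponding power of the
density of a function on `k`-tuples. -/
lemma expect_pow_le_expect_prod {V : Type*} [Fintype V] [Nonempty V] {t : ℕ} (ht : t ≠ 0) :
    ∀ (k : ℕ) (f : (Fin k → V) → ℝ), (∀ v, 0 ≤ f v) →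
      (𝔼 v, f v) ^ t ^ k ≤
        𝔼 x : Fin k → Fin t → V, ∏ j : Fin k → Fin t, f fun i => x i (j i)
  | 0, f, hf => by
    have h (v : Fin 0 → V) : f v = f Fin.elim0 := congrArg f (Subsingleton.elim _ _)
    simp [h]
  | k + 1, f, hf => by
    -- The first coordinate is replaced by `t` copies `y`; Jensen is applied once over the other
    -- coordinates and once over `y`, and induction treats each `g y`.
    let g (y : Fin t → V) (x : Fin k → V) : ℝ := ∏ a, f (Fin.cons (y a) x)
    have hg (y) (x) : 0 ≤ g y x := Finset.prod_nonneg fun _ _ => hf _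
    calc (𝔼 v, f v) ^ t ^ (k + 1)
        = ((𝔼 x : Fin k → V, 𝔼 a, f (Fin.cons a x)) ^ t) ^ t ^ k := by
          rw [expect_fin_cons, Finset.expect_comm, ← pow_mul, pow_succ']
      _ ≤ (𝔼 x : Fin k → V, (𝔼 a, f (Fin.cons a x)) ^ t) ^ t ^ k := by
          have h0 (x : Fin k → V) : 0 ≤ 𝔼 a, f (Fin.cons a x) :=
            Finset.expect_nonneg fun _ _ => hf _
          gcongr
          · exact pow_nonneg (Finset.expect_nonneg fun x _ => h0 x) _
          · exact expect_pow_le h0 ht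
      _ = (𝔼 y, 𝔼 x, g y x) ^ t ^ k := by
          rw [Finset.expect_comm]
          congr 2 with x
          rw [Finset.expect_pow, Fintype.piFinset_univ]
      _ ≤ 𝔼 y, (𝔼 x, g y x) ^ t ^ k :=
          expect_pow_le (fun y => Finset.expect_nonneg fun x _ => hg y x) (pow_ne_zero _ ht)
      _ ≤ 𝔼 y, 𝔼 x : Fin k → Fin t → V, ∏ j : Fin k → Fin t, g y fun i => x i (j i) :=
          Finset.expect_le_expect fun y _ => expect_pow_le_expect_prod ht k (g y) (hg y)
      _ = _ := by
          rw [expect_fin_cons]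
          congr 1 with y
          congr 1 with x
          rw [← (Fin.consEquiv fun _ => Fin t).prod_comp, Fintype.prod_prod_type,
            Finset.prod_comm]
          refine Finset.prod_congr rfl fun j _ => Finset.prod_congr rfl fun a _ => congrArg f ?_
          ext i
          refine Fin.cases ?_ (fun i => ?_) i <;> simp [Fin.consEquiv]

/-- The proportion of non-injective functions is at most `|κ|² / |V|`. -/
lemma card_not_injective_mul_le {κ V : Type*} [Fintype κ] [Fintype V] [DecidableEq κ]
    [DecidableEq V] :
    #{x : κ → V | ¬ x.Injective} * Fintype.card V ≤
      Fintype.card κ ^ 2 * Fintype.card (κ → V) := by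
  have hpair (p : κ × κ) (hp : p.1 ≠ p.2) :
      #{x : κ → V | x p.1 = x p.2} * Fintype.card V ≤ Fintype.card (κ → V) := by
    rw [← Finset.card_univ (α := V), ← Finset.card_product, ← Finset.card_univ (α := κ → V)]
    -- The overwritten value is recoverable, being equal to the coordinate at `p.2`.
    refine Finset.card_le_card_of_injOn (fun q => Function.update q.1 p.1 q.2)
      (fun _ _ => Finset.mem_coe.2 (Finset.mem_univ _)) ?_
    rintro ⟨x, a⟩ hx ⟨y, b⟩ hy hxy
    simp only [Finset.coe_product, Set.mem_prod, Finset.mem_coe, Finset.mem_filter,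
      Finset.mem_univ, true_and, and_true] at hx hy hxy
    have hne (i) (hi : i ≠ p.1) : x i = y i := by
      simpa [hi] using congrFun hxy i
    refine Prod.ext (funext fun i => ?_) (by simpa using congrFun hxy p.1)
    by_cases hi : i = p.1
    · subst hi
      exact hx.trans ((hne _ hp.symm).trans hy.symm)
    · exact hne i hi
  have hsub : ({x : κ → V | ¬ x.Injective} : Finset _) ⊆
      (Finset.univ.filter fun p : κ × κ => p.1 ≠ p.2).biUnion
        fun p => {x : κ → V | x p.1 = x p.2} := by
    intro x hx
    obtain ⟨i, j, hij, hne⟩ := Function.not_injective_iff.1 (Finset.mem_filter.1 hx).2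
    exact Finset.mem_biUnion.2 ⟨(i, j), by simpa using hne, by simpa using hij⟩
  calc _ ≤ (∑ p : κ × κ with p.1 ≠ p.2, #{x : κ → V | x p.1 = x p.2}) * Fintype.card V := by
        gcongr
        exact (Finset.card_le_card hsub).trans Finset.card_biUnion_le
    _ = ∑ p : κ × κ with p.1 ≠ p.2, #{x : κ → V | x p.1 = x p.2} * Fintype.card V :=
        Finset.sum_mul ..
    _ ≤ #(Finset.univ.filter fun p : κ × κ => p.1 ≠ p.2) * Fintype.card (κ → V) := by
        refine Finset.sum_le_card_nsmul _ _ _ fun p hp => hpair p ?_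
        simpa using hp
    _ ≤ _ := by
        gcongr
        refine (Finset.card_le_univ _).trans_eq ?_
        rw [Fintype.card_prod, sq]

/-- **Erdős' theorem**: a dense `k`-uniform family of edges contains a complete `k`-partite family
with parts of size `t`. -/
lemma eventually_exists_blowup (k t : ℕ) (ht : t ≠ 0) {ε : ℝ} (hε : 0 < ε) :
    ∀ᶠ n : ℕ in atTop, ∀ E : Set (Set (Fin n)), (∀ e ∈ E, e.ncard = k) →
      ε * n ^ k < E.ncard →
      ∃ x : Fin k → Fin t → Fin n, (∀ i a i' a', x i a = x i' a' → i = i' ∧ a = a') ∧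
        ∀ j : Fin k → Fin t, (Set.range fun i => x i (j i)) ∈ E := by
  have hδ : 0 < ε ^ t ^ k := by positivity
  have hlim : Tendsto (fun n : ℕ => ε ^ t ^ k * (n : ℝ)) atTop atTop :=
    tendsto_natCast_atTop_atTop.const_mul_atTop hδ
  -- For such `n` the blow-up density `ε ^ t ^ k` exceeds `(k * t) ^ 2 / n`, which bounds the
  -- proportion of degenerate blow-ups.
  filter_upwards [hlim.eventually (eventually_gt_atTop (((k * t) ^ 2 : ℕ) : ℝ)),
    eventually_gt_atTop 0] with n hn hn0 E hEk hE
  classical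
  have : NeZero n := ⟨hn0.ne'⟩
  have hnpos : (0 : ℝ) < n := by exact_mod_cast hn0
  let f : (Fin k → Fin n) → ℝ := fun v => if Set.range v ∈ E then 1 else 0
  have hf (v) : 0 ≤ f v := by
    simp only [f]; split_ifs <;> norm_num
  have hfE : ε ≤ 𝔼 v, f v := by
    rw [Fintype.expect_eq_sum_div_card, le_div_iff₀ (by positivity)]
    simp only [f, Finset.sum_boole, Fintype.card_fun, Fintype.card_fin, Nat.cast_pow]
    refine hE.le.trans ?_
    norm_cast
    refine (Set.ncard_le_ncard (t := Set.range '' {v : Fin k → Fin n | Set.range v ∈ E}) ?_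
      (Set.toFinite _)).trans ((Set.ncard_image_le (Set.toFinite _)).trans_eq
      (by rw [← Set.ncard_coe_finset]; simp))
    intro e he
    have hc : Fintype.card e = k := by
      rw [← Nat.card_eq_fintype_card, Nat.card_coe_set_eq, hEk e he]
    let φ := (Fintype.equivFinOfCardEq hc).symm
    have hr : Set.range (fun i => (φ i : Fin n)) = e := by
      rw [show (fun i => (φ i : Fin n)) = Subtype.val ∘ φ from rfl, Set.range_comp,
        φ.range_eq_univ, Set.image_univ, Subtype.range_coe]
    exact ⟨fun i => φ i, by simpa [hr] using he, hr⟩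
  by_contra! hcon
  -- Without a genuine blow-up in `E`, only non-injective choices contribute.
  have hzero (x : Fin k → Fin t → Fin n) :
      ∏ j : Fin k → Fin t, f (fun i => x i (j i)) ≤
        if ¬ (Function.uncurry x).Injective then 1 else 0 := by
    split_ifs with hx
    · obtain ⟨j, hj⟩ := hcon x fun i a i' a' h => by
        simpa using hx (a₁ := (i, a)) (a₂ := (i', a')) h
      exact (Finset.prod_eq_zero (Finset.mem_univ j) (by simp [f, hj])).le
    · exact Finset.prod_le_one (fun _ _ => hf _)
        fun _ _ => by simp only [f]; split_ifs <;> norm_num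
  have hmain : ε ^ t ^ k ≤ 𝔼 x : Fin k → Fin t → Fin n,
      if ¬ (Function.uncurry x).Injective then (1 : ℝ) else 0 :=
    (pow_le_pow_left₀ hε.le hfE _).trans <| (expect_pow_le_expect_prod ht k f hf).trans <|
      Finset.expect_le_expect fun x _ => hzero x
  have hcurry := Fintype.expect_equiv (Equiv.curry (Fin k) (Fin t) (Fin n)).symm
    (fun x => if ¬ (Function.uncurry x).Injective then (1 : ℝ) else 0)
    (fun y => if ¬ y.Injective then (1 : ℝ) else 0) (fun x => rfl)
  rw [hcurry,
    Fintype.expect_eq_sum_div_card, le_div_iff₀ (by positivity), Finset.sum_boole] at hmain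
  have hcount := card_not_injective_mul_le (κ := Fin k × Fin t) (V := Fin n)
  have hcount' : (#{y : Fin k × Fin t → Fin n | ¬ y.Injective} * n : ℝ) ≤
      ((k * t) ^ 2 : ℕ) * Fintype.card (Fin k × Fin t → Fin n) := by
    simp only [Fintype.card_prod, Fintype.card_fin] at hcount ⊢
    exact_mod_cast hcount
  have hcard : (0 : ℝ) < Fintype.card (Fin k × Fin t → Fin n) := by positivity
  have := mul_lt_mul_of_pos_right hn hcard
  have := mul_le_mul_of_nonneg_right hmain hnpos.le
  linarith

variable {α β : Type*}

/-- As `sInf ∅ = 0`, the bound `1 ≤ k` is what makes the infimum attained. -/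
lemma exists_coloring_of_chromaticNumber_eq {F : Hypergraph α} {k : ℕ} (hk : 1 ≤ k)
    (h : F.chromaticNumber = k) :
    ∃ c : α → ℕ, (∀ x ∈ F.vertexSet, c x < k) ∧ ∀ e ∈ F.edgeSet, Set.InjOn c e := by
  subst h
  exact Nat.sInf_mem (Nat.nonempty_of_pos_sInf hk)

/-- Dense families of edges contain a copy of a given `k`-partite hypergraph. -/
lemma eventually_exists_isCopy {F : Hypergraph α} {k : ℕ} (hF : F.IsUniform k)
    (hFfin : F.vertexSet.Finite) (hFv : F.vertexSet.Nonempty) {c : α → ℕ}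
    (hc : ∀ x ∈ F.vertexSet, c x < k) (hce : ∀ e ∈ F.edgeSet, Set.InjOn c e)
    {ε : ℝ} (hε : 0 < ε) :
    ∀ᶠ n : ℕ in atTop, ∀ E : Set (Set (Fin n)), (∀ e ∈ E, e.ncard = k) →
      ε * n ^ k < E.ncard → ∃ D : Hypergraph (Fin n), F.IsCopy D ∧ D.edgeSet ⊆ E := by
  classical
  have := hFfin.fintype
  have := hFv.to_subtype
  let φ := Fintype.equivFin F.vertexSet
  filter_upwards [eventually_exists_blowup k (Fintype.card F.vertexSet) Fintype.card_ne_zero hε]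
    with n hn E hEk hE
  obtain ⟨x, hx, hxE⟩ := hn E hEk hE
  obtain ⟨v₀, hv₀⟩ := hFv
  -- The colour selects the part and `φ` the position in it. Parts of size `v(F)` make `φ` alone
  -- ensure injectivity; values off `F` are irrelevant.
  let g (v : α) : Fin n :=
    if hv : v ∈ F.vertexSet then x ⟨c v, hc v hv⟩ (φ ⟨v, hv⟩) else
      x ⟨c v₀, hc v₀ hv₀⟩ (φ ⟨v₀, hv₀⟩)
  have hg (v) (hv : v ∈ F.vertexSet) : g v = x ⟨c v, hc v hv⟩ (φ ⟨v, hv⟩) := dif_pos hv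
  refine ⟨F.image g, ⟨g, ?_, rfl⟩, ?_⟩
  · intro v hv w hw hvw
    rw [hg v hv, hg w hw] at hvw
    simpa using φ.injective (hx _ _ _ _ hvw).2
  · rintro _ ⟨e, he, rfl⟩
    have hev := he.subset_vertexSet
    have hefin : e.Finite := hFfin.subset hev
    -- An edge has `k` distinct colours below `k`, hence meets every part once.
    have hsurj (i : Fin k) : ∃ v ∈ e, c v = i := by
      have hsub : c '' e ⊆ Set.Iio k := by
        rintro _ ⟨v, hv, rfl⟩
        exact hc v (hev hv)
      have heq := Set.eq_of_subset_of_ncard_le hsub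
        (by rw [(hce e he).ncard_image, hF.ncard_eq he]; simp [Set.ncard_eq_toFinset_card'])
        (Set.finite_Iio k)
      have hi : (i : ℕ) ∈ c '' e := by
        rw [heq]
        exact i.2
      exact hi
    choose w hwe hwc using hsurj
    convert hxE fun i => φ ⟨w i, hev (hwe i)⟩ using 1
    have hgw (i) : g (w i) = x i (φ ⟨w i, hev (hwe i)⟩) := by
      rw [hg _ (hev (hwe i)), show (⟨c (w i), hc _ (hev (hwe i))⟩ : Fin k) = i from Fin.ext (hwc i)]
    ext y
    constructor
    · rintro ⟨v, hv, rfl⟩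
      refine ⟨⟨c v, hc v (hev hv)⟩, ?_⟩
      have : w ⟨c v, hc v (hev hv)⟩ = v := hce e he (hwe _) hv (hwc _)
      exact (hgw _).symm.trans (congrArg g this)
    · rintro ⟨i, rfl⟩
      exact ⟨w i, hwe i, hgw i⟩

/-- If every family of more than `s` edges contains a copy of `F`, then one can greedily choose
pairwise edge-disjoint copies of `F` inside any family of edges, leaving at most `s` of them. -/
lemma exists_packing {F : Hypergraph α} (hFe : F.edgeSet.Nonempty) (hFfin : F.edgeSet.Finite)
    {n k : ℕ} {s : ℝ} (hs : 0 ≤ s)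
    (hcopy : ∀ E : Set (Set (Fin n)), (∀ e ∈ E, e.ncard = k) → s < E.ncard →
      ∃ D : Hypergraph (Fin n), F.IsCopy D ∧ D.edgeSet ⊆ E) (r : ℕ) :
    ∀ E : Set (Set (Fin n)), (∀ e ∈ E, e.ncard = k) → E.ncard ≤ r →
      ∃ (m : ℕ) (C : Fin m → Hypergraph (Fin n)), (∀ i, F.IsCopy (C i)) ∧
        (∀ i j, i ≠ j → Disjoint (C i).edgeSet (C j).edgeSet) ∧
        (∀ i, (C i).edgeSet ⊆ E) ∧ (E.ncard : ℝ) ≤ m * F.edgeSet.ncard + s := by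
  induction r with
  | zero =>
    intro E _ hE
    exact ⟨0, fun i => i.elim0, fun i => i.elim0, fun i => i.elim0, fun i => i.elim0, by
      simpa [Nat.le_zero.1 hE] using hs⟩
  | succ r ih =>
    intro E hEk hE
    by_cases hsE : s < E.ncard
    · obtain ⟨D, hD, hDE⟩ := hcopy E hEk hsE
      have hpos : 0 < F.edgeSet.ncard := (Set.ncard_pos hFfin).2 hFe
      have hdiff : (E \ D.edgeSet).ncard + F.edgeSet.ncard = E.ncard := by
        rw [← hD.ncard_edgeSet]
        exact Set.ncard_sdiff_add_ncard_of_subset hDE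
      obtain ⟨m, C, hC, hdisj, hCE, hm⟩ := ih (E \ D.edgeSet) (fun e he => hEk e he.1) (by omega)
      have hdisj' (i) : Disjoint D.edgeSet (C i).edgeSet :=
        Set.disjoint_left.2 fun e he he' => (hCE i he').2 he
      refine ⟨m + 1, Fin.cons D C, ?_, ?_, ?_, ?_⟩
      · exact Fin.cases hD hC
      · refine Fin.cases (Fin.cases ?_ fun j _ => ?_) fun i => Fin.cases (fun _ => ?_) fun j h => ?_
        · exact fun h => (h rfl).elim
        · simpa using hdisj' j
        · simpa using (hdisj' i).symm
        · simpa using hdisj i j fun hij => h (congrArg _ hij)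
      · exact Fin.cases hDE fun i => (hCE i).trans Set.sdiff_subset
      · rw [← hdiff]
        push_cast
        linarith
    · exact ⟨0, fun i => i.elim0, fun i => i.elim0, fun i => i.elim0, fun i => i.elim0, by
        simpa using hsE⟩

/-- `ex_k(n, G) ≤ ex_F(n, G) e(F) + o(n^k)` for `k`-partite `F`. -/
lemma eventually_turanNumber_le {F : Hypergraph α} {G : Hypergraph β} {k : ℕ} (hk : 1 ≤ k)
    (hF : F.IsUniform k) (hFfin : F.vertexSet.Finite) (hFe : F.edgeSet.Nonempty)
    (hG : G.edgeSet.Nonempty) (hχ : F.chromaticNumber = k) {ε : ℝ} (hε : 0 < ε) :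
    ∀ᶠ n : ℕ in atTop, (turanNumber k G n : ℝ) ≤
      multicolorTuranNumber F G n * F.edgeSet.ncard + ε * n ^ k := by
  obtain ⟨c, hc, hce⟩ := exists_coloring_of_chromaticNumber_eq hk hχ
  have hFefin : F.edgeSet.Finite := hFfin.powerset.subset edgeSet_subset_powerset_vertexSet
  have hFv : F.vertexSet.Nonempty := by
    obtain ⟨e, he⟩ := hFe
    have : e.ncard ≠ 0 := by rw [hF.ncard_eq he]; omega
    exact (Set.nonempty_of_ncard_ne_zero this).mono he.subset_vertexSet
  filter_upwards [eventually_exists_isCopy hF hFfin hFv hc hce hε] with n hn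
  obtain ⟨H, hHv, hHk, hHG, hH⟩ := exists_turanNumber hG k n
  obtain ⟨m, C, hC, hdisj, hCH, hm⟩ := exists_packing hFe hFefin (by positivity) hn _ H.edgeSet
    (fun e he => hHk.ncard_eq he) le_rfl
  -- All copies lie in `H`, so even a non-rainbow copy of `G` is excluded.
  have hle := card_le_multicolorTuranNumber hFe (G := G) C hC hdisj (by
    rintro ⟨D, hD, d, -, hd⟩
    exact hHG ⟨D, hD, by simp [hHv], fun e he => hCH _ (hd ⟨e, he⟩)⟩)
  rw [Fintype.card_fin] at hle
  rw [← hH]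
  refine hm.trans ?_
  gcongr

end Erdos

/-! ### Lower bound by polynomials in a blow-up -/

section Blowup

open scoped Nat

/-- Polynomials of degree less than `k` over `ZMod M` are determined by their values at `k` distinct
natural numbers less than `v`, provided `M` is coprime to `v!`. -/
lemma eq_of_sum_mul_pow_eq {M v k : ℕ} (hM : M.Coprime v !) {x : Fin k → ℕ}
    (hx : x.Injective) (hv : ∀ i, x i < v) {a b : Fin k → ZMod M}
    (h : ∀ i, ∑ j : Fin k, a j * (x i : ZMod M) ^ (j : ℕ) =
      ∑ j : Fin k, b j * (x i : ZMod M) ^ (j : ℕ)) : a = b := by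
  -- Positive differences of numbers below `v` divide `v !`, so they are units modulo `M`. The
  -- Vandermonde determinant is then a unit without `M` being prime.
  have hlt {y z : ℕ} (hyz : y < z) (hz : z < v) : IsUnit ((z : ZMod M) - y) := by
    rw [← Nat.cast_sub hyz.le, ZMod.isUnit_iff_coprime]
    exact (hM.coprime_dvd_right (Nat.dvd_factorial (by omega) (by omega))).symm
  have hunit : IsUnit (Matrix.vandermonde fun i => (x i : ZMod M)) := by
    rw [Matrix.isUnit_iff_isUnit_det, Matrix.det_vandermonde]
    refine IsUnit.prod_iff.2 fun i _ => IsUnit.prod_iff.2 fun j hj => ?_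
    have hne : x i ≠ x j := hx.ne (Finset.mem_Ioi.1 hj).ne
    obtain hij | hij := hne.lt_or_gt
    · exact hlt hij (hv j)
    · rw [← neg_sub]
      exact (hlt hij (hv i)).neg
  refine Matrix.mulVec_injective_of_isUnit hunit (funext fun i => ?_)
  simpa [Matrix.mulVec, dotProduct, Matrix.vandermonde_apply, mul_comm] using h i

variable {α β : Type*}

/-- For edgeless `G`, a constant map to a vertex of `F` is a homomorphism. -/
lemma edgeSet_nonempty_of_not_hasHom {F : Hypergraph α} {G : Hypergraph β}
    (hF : F.vertexSet.Nonempty) (hhom : ¬ G.HasHom F) : G.edgeSet.Nonempty := by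
  by_contra hG
  rw [Set.not_nonempty_iff_eq_empty] at hG
  obtain ⟨v, hv⟩ := hF
  exact hhom ⟨fun _ => v, fun _ _ => hv, by simp [hG]⟩

/-- The balanced blow-up of `F` contains `M ^ k` edge-disjoint copies of `F`, given by the
polynomials of degree less than `k` over `ZMod M`, and no copy of `G`. -/
lemma pow_le_multicolorTuranNumber {F : Hypergraph α} {G : Hypergraph β} {k M n : ℕ}
    (hF : F.IsUniform k) (hFfin : F.vertexSet.Finite) (hFv : F.vertexSet.Nonempty)
    (hFe : F.edgeSet.Nonempty) (hhom : ¬ G.HasHom F) (hM0 : M ≠ 0)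
    (hM : M.Coprime (F.vertexSet.ncard)!) (hn : F.vertexSet.ncard * M ≤ n) :
    M ^ k ≤ multicolorTuranNumber F G n := by
  classical
  have := hFfin.fintype
  have : NeZero M := ⟨hM0⟩
  rw [Set.ncard_eq_toFinset_card', Set.toFinset_card] at hM hn
  let idx := Fintype.equivFin F.vertexSet
  obtain ⟨ψ⟩ : Nonempty (F.vertexSet × ZMod M ↪ Fin n) :=
    Function.Embedding.nonempty_of_card_le (by simpa [ZMod.card] using hn)
  obtain ⟨v₀, hv₀⟩ := hFv
  let poly (a : Fin k → ZMod M) (u : F.vertexSet) : ZMod M :=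
    ∑ j : Fin k, a j * ((idx u : ℕ) : ZMod M) ^ (j : ℕ)
  let g (a : Fin k → ZMod M) (u : α) : Fin n :=
    if hu : u ∈ F.vertexSet then ψ (⟨u, hu⟩, poly a ⟨u, hu⟩) else ψ (⟨v₀, hv₀⟩, 0)
  have hg (a u) (hu : u ∈ F.vertexSet) : g a u = ψ (⟨u, hu⟩, poly a ⟨u, hu⟩) := dif_pos hu
  -- The projection of the blow-up to `F`. The default off the range of `ψ` still lies in `F`, so
  -- isolated vertices of `G` cause no trouble.
  let label : Fin n → F.vertexSet := Function.extend ψ Prod.fst fun _ => ⟨v₀, hv₀⟩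
  have hlabel (a u) (hu : u ∈ F.vertexSet) : (label (g a u) : α) = u := by
    rw [hg a u hu]
    exact congrArg Subtype.val (ψ.injective.extend_apply _ _ _)
  have hcard : Fintype.card (Fin k → ZMod M) = M ^ k := by simp [ZMod.card]
  rw [← hcard]
  refine card_le_multicolorTuranNumber hFe (fun a => F.image (g a)) (fun a => ⟨g a, ?_, rfl⟩) ?_ ?_
  · intro u hu w hw huw
    rw [← hlabel a u hu, huw, hlabel a w hw]
  · intro a b hab
    refine Set.disjoint_left.2 ?_
    rintro _ ⟨e, he, rfl⟩ ⟨e', he', hee⟩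
    refine hab ?_
    have hev := he.subset_vertexSet
    -- Labels identify the vertices of a shared edge, so both polynomials agree at its `k` points.
    have hpoly (u) (hu : u ∈ e) : poly a ⟨u, hev hu⟩ = poly b ⟨u, hev hu⟩ := by
      obtain ⟨u', hu', huu⟩ : g a u ∈ g b '' e' := hee ▸ Set.mem_image_of_mem _ hu
      obtain rfl : u' = u := by
        rw [← hlabel b u' (he'.subset_vertexSet hu'), huu, hlabel a u (hev hu)]
      rw [hg _ _ (hev hu), hg _ _ (hev hu)] at huu
      exact (congrArg Prod.snd (ψ.injective huu)).symm
    have := (hFfin.subset hev).fintype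
    have hc : Fintype.card e = k := by
      rw [← Nat.card_eq_fintype_card, Nat.card_coe_set_eq, hF.ncard_eq he]
    let w := (Fintype.equivFinOfCardEq hc).symm
    refine eq_of_sum_mul_pow_eq hM (x := fun i => idx ⟨w i, hev (w i).2⟩) ?_ (fun i => (idx _).2)
      fun i => hpoly _ (w i).2
    intro i j hij
    have := idx.injective (Fin.ext hij)
    exact w.injective (Subtype.ext (Subtype.mk.inj this))
  · rintro ⟨_, ⟨f, hf, rfl⟩, c, -, hc⟩
    refine hhom ⟨fun x => label (f x), fun x _ => (label (f x)).2, fun e he => ?_⟩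
    obtain ⟨e', he', hee⟩ := hc ⟨f '' e, image_mem_edgeSet_image he⟩
    have h1 : (fun x => (label (f x) : α)) '' e = (fun y => (label y : α)) '' (f '' e) := by
      rw [Set.image_image]
    have h2 : (fun y => (label y : α)) '' (f '' e) = e' := by
      change _ '' e' = f '' e at hee
      rw [← hee, Set.image_image]
      exact (Set.image_congr fun u hu => hlabel _ u (he'.subset_vertexSet hu)).trans (by simp)
    rwa [h1, h2]

/-- `n^k / v(F)^k ≤ ex_F(n, G) + o(n^k)`. -/
lemma eventually_pow_div_le {F : Hypergraph α} {G : Hypergraph β} {k : ℕ}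
    (hF : F.IsUniform k) (hFfin : F.vertexSet.Finite) (hFv : F.vertexSet.Nonempty)
    (hFe : F.edgeSet.Nonempty) (hhom : ¬ G.HasHom F) {ε : ℝ} (hε : 0 < ε) :
    ∀ᶠ n : ℕ in atTop, (n : ℝ) ^ k / (F.vertexSet.ncard : ℝ) ^ k ≤
      multicolorTuranNumber F G n + ε * n ^ k := by
  set v := F.vertexSet.ncard with hv
  have hv0 : 0 < v := (Set.ncard_pos hFfin).2 hFv
  have hv1 : (1 : ℝ) ≤ v := by exact_mod_cast hv0
  have hlim : Tendsto (fun n : ℕ => (1 - (v * (v ! + 1) : ℝ) / n) ^ k) atTop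
      (nhds ((1 - 0) ^ k)) :=
    (tendsto_const_nhds.sub (tendsto_const_nhds.div_atTop tendsto_natCast_atTop_atTop)).pow k
  rw [sub_zero, one_pow] at hlim
  filter_upwards [hlim.eventually (lt_mem_nhds (sub_lt_self 1 hε)),
    eventually_ge_atTop (v * (v ! + 1))] with n hn hnv
  have hnpos : (0 : ℝ) < n := by
    have : 0 < v * (v ! + 1) := by positivity
    exact_mod_cast this.trans_le hnv
  have hq : v ! + 1 ≤ n / v := (Nat.le_div_iff_mul_le hv0).2 (by rwa [mul_comm])
  -- The largest number up to `n / v` congruent to 1 modulo `v !`: coprime to `v !`, and short of `n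
  -- / v` by less than `v !`.
  set M := (n / v - 1) / v ! * v ! + 1 with hMdef
  have hdiv := Nat.div_add_mod' (n / v - 1) v !
  have hmod := Nat.mod_lt (n / v - 1) (Nat.factorial_pos v)
  have hMle : M ≤ n / v := by omega
  have hMge : n / v ≤ M + v ! := by omega
  have hcop : M.Coprime v ! := by
    rw [hMdef]
    simp
  have hvM : v * M ≤ n := (Nat.mul_le_mul_left _ hMle).trans (Nat.mul_div_le n v)
  have hmain := pow_le_multicolorTuranNumber (G := G) hF hFfin hFv hFe hhom
    (Nat.succ_ne_zero _) hcop hvM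
  have hmain' : (M : ℝ) ^ k ≤ multicolorTuranNumber F G n := by exact_mod_cast hmain
  have hnM : n ≤ v * M + v * (v ! + 1) := by
    calc n ≤ v * (n / v + 1) := (Nat.lt_mul_div_succ n hv0).le
      _ ≤ v * (M + v ! + 1) := by gcongr
      _ = _ := by ring
  have hnM' : (n : ℝ) ≤ v * M + v * (v ! + 1) := by exact_mod_cast hnM
  have hnv' : (v * (v ! + 1) : ℝ) ≤ n := by exact_mod_cast hnv
  have hfrac : (n : ℝ) / v * (1 - v * (v ! + 1) / n) ≤ M := by
    have : (n : ℝ) / v * (1 - v * (v ! + 1) / n) = (n - v * (v ! + 1)) / v := by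
      field_simp
    rw [this, div_le_iff₀ (by linarith)]
    linarith
  have hpow : ((n : ℝ) / v) ^ k * (1 - ε) ≤ M ^ k := by
    calc ((n : ℝ) / v) ^ k * (1 - ε) ≤ (n / v) ^ k * (1 - v * (v ! + 1) / n) ^ k := by gcongr
      _ = (n / v * (1 - v * (v ! + 1) / n)) ^ k := (mul_pow _ _ _).symm
      _ ≤ M ^ k := by
        refine pow_le_pow_left₀ (mul_nonneg (by positivity) ?_) hfrac k
        rw [sub_nonneg]
        exact (div_le_one hnpos).2 hnv'
  have hle : ((n : ℝ) / v) ^ k ≤ n ^ k := by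
    gcongr
    exact div_le_self hnpos.le hv1
  rw [← div_pow]
  nlinarith

end Blowup

/-! ### From `ε`-inequalities to error functions -/

section Asymptotic

/-- The truncated difference `min 0 (g - f)` works at every `n`, including those below the
thresholds. -/
lemma exists_isLittleO_add_le {f g h : ℕ → ℝ} (hh : ∀ n, 0 ≤ h n)
    (hfg : ∀ ε : ℝ, 0 < ε → ∀ᶠ n in atTop, f n ≤ g n + ε * h n) :
    ∃ r : ℕ → ℝ, r =o[atTop] h ∧ ∀ n, f n + r n ≤ g n := by
  refine ⟨fun n => min 0 (g n - f n), isLittleO_iff.2 fun ε hε => ?_, fun n => ?_⟩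
  · filter_upwards [hfg ε hε] with n hn
    rw [Real.norm_of_nonneg (hh n), Real.norm_of_nonpos (min_le_left _ _), neg_le, le_min_iff]
    have := mul_nonneg hε.le (hh n)
    constructor <;> linarith
  · linarith [min_le_right 0 (g n - f n)]

end Asymptotic

end Hypergraph

theorem theorem1p9 {α β : Type*} (k : ℕ) (hk : 1 ≤ k)
    (F : Hypergraph α) (G : Hypergraph β)
    (hFfin : F.vertexSet.Finite) (hGfin : G.vertexSet.Finite)
    (hF : F.IsUniform k) (hG : G.IsUniform k)
    (hFne : F.edgeSet.Nonempty)
    (hhom : ¬ G.HasHom F) :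
    (∃ r : ℕ → ℝ, r =o[atTop] (fun n : ℕ => (n : ℝ) ^ k) ∧
      ∀ n : ℕ, (n : ℝ) ^ k / (F.vertexSet.ncard : ℝ) ^ k + r n
        ≤ (F.multicolorTuranNumber G n : ℝ)) ∧
    (∃ r : ℕ → ℝ, r =o[atTop] (fun n : ℕ => (n : ℝ) ^ k) ∧
      ∀ n : ℕ, (F.multicolorTuranNumber G n : ℝ)
        ≤ (Hypergraph.turanNumber k G n : ℝ) / (F.edgeSet.ncard : ℝ) + r n) ∧
    (F.chromaticNumber = k →
      (fun n : ℕ => (F.multicolorTuranNumber G n : ℝ)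
          - (Hypergraph.turanNumber k G n : ℝ) / (F.edgeSet.ncard : ℝ))
        =o[atTop] (fun n : ℕ => (n : ℝ) ^ k)) := by
  have hFefin : F.edgeSet.Finite :=
    hFfin.powerset.subset Hypergraph.edgeSet_subset_powerset_vertexSet
  have hFv : F.vertexSet.Nonempty := by
    obtain ⟨e, he⟩ := hFne
    have : e.ncard ≠ 0 := by rw [hF.ncard_eq he]; omega
    exact (Set.nonempty_of_ncard_ne_zero this).mono he.subset_vertexSet
  have hGne := Hypergraph.edgeSet_nonempty_of_not_hasHom hFv hhom
  have hpow (n : ℕ) : (0 : ℝ) ≤ (n : ℝ) ^ k := by positivity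
  have he : (0 : ℝ) < F.edgeSet.ncard := by exact_mod_cast (Set.ncard_pos hFefin).2 hFne
  have hupper (ε : ℝ) (hε : 0 < ε) : ∀ᶠ n : ℕ in atTop, (F.multicolorTuranNumber G n : ℝ) ≤
      (Hypergraph.turanNumber k G n : ℝ) / (F.edgeSet.ncard : ℝ) + ε * (n : ℝ) ^ k := by
    -- Error `ε * e(F)` becomes `ε` after division by `e(F)`.
    filter_upwards [Hypergraph.eventually_multicolorTuranNumber_mul_le hF hFne hFefin hGne
      (mul_pos hε he)] with n hn
    rw [← le_div_iff₀ he] at hn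
    refine hn.trans_eq ?_
    field_simp
  refine ⟨Hypergraph.exists_isLittleO_add_le hpow fun ε hε =>
    Hypergraph.eventually_pow_div_le hF hFfin hFv hFne hhom hε, ?_, fun hχ => ?_⟩
  · obtain ⟨r, hr, hle⟩ := Hypergraph.exists_isLittleO_add_le hpow hupper
    exact ⟨fun n => -r n, hr.neg_left, fun n => by linarith [hle n]⟩
  · refine isLittleO_iff.2 fun ε hε => ?_
    filter_upwards [hupper ε hε, Hypergraph.eventually_turanNumber_le hk hF hFfin hFne hGne hχ
      (mul_pos hε he)] with n hn hn'
    have hn'' : (Hypergraph.turanNumber k G n : ℝ) / F.edgeSet.ncard ≤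
        F.multicolorTuranNumber G n + ε * (n : ℝ) ^ k := by
      rw [div_le_iff₀ he]
      linarith
    rw [Real.norm_of_nonneg (hpow n), Real.norm_eq_abs, abs_le]
    constructor <;> linarith
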